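/- Let $\Gamma$ be a finite metric graph with $N$ internal edges, all of the same length $\ell>0$, and finitely many external edges (half-lines), such that every vertex is an endpoint of at least one edge; multiple edges and loops are allowed. Let $\Gamma$ carry the operator $-\mathrm{d}^2/\mathrm{d}x^2$ with standard coupling: at every vertex the functions are continuous and the sum of the outgoing derivatives vanishes. A number $k\in\mathbb{C}$ is called a resonance if there is a function $f\not\equiv 0$ on $\Gamma$ with $-f''=k^2f$ on all edges that satisfies the coupling conditions and equals $c_j\,\mathrm{e}^{ikx}$ on the $j$-th half-line, for constants $c_j\in\mathbb{C}$. Its multiplicity is its order as a zero of the determinant of the linear system that the coupling conditions, in the form $(U-I)\Psi+i(U+I)\Psi'=0$ with $U$ having the block $\frac{2}{d}J_d-I_d$ at each vertex of degree $d$ (where $\Psi$ and $\Psi'$ are the vectors of values and outgoing derivatives at the edge ends, $I$ and $I_d$ are identity matrices, and $J_d$ is the $d\times d$ matrix with all entries equal to one), impose on the values and derivatives of $f$ at the initial points of the internal edges and on the constants $c_j$. Let $N(R)$ be the number of resonances $k$ with $|k|\le R$, counted with multiplicity. The effective size of $\Gamma$ is the number $W$ such that $$N(R)=\frac{2}{\pi}WR+\mathcal{O}(1)\quad\text{as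 } R\to\infty .$$ A vertex is balanced if the number of internal edges emanating from it (loops counted twice) equals the number of half-lines attached to it. Two vertices are neighbours if an internal edge joins them; in particular, a vertex that carries a loop is its own neighbour. Let $n_{\mathrm{bal}}$ be the number of balanced vertices, and $n_{\mathrm{nonneig}}$ the number of balanced vertices that have no balanced neighbour. Then $N(R)$ is finite for every $R$, the effective size $W$ exists, and $$W\le N\ell-\frac{\ell}{2}\,n_{\mathrm{bal}}-\frac{\ell}{2}\,n_{\mathrm{nonneig}} .$$ -/

import Mathlib

open Filter Asymptotics
open scoped ENNReal

noncomputable section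

/-- A metric graph with vertex set `V`, finite internal edges `E` and semi-infinite external edges
(leads) `L`. The edge `e` is parametrized by `[0, length e]`, with `x = 0` at `src e` and
`x = length e` at `tgt e`; the lead `s` is parametrized by `[0, ∞)`, with `x = 0` at `lead s`.
Loops, multiple edges and several components are allowed. -/
structure MetricGraph (V E L : Type*) where
  src : E → V
  tgt : E → V
  lead : L → V
  length : E → ℝ
  length_pos : ∀ e, 0 < length e

namespace MetricGraph

variable {V E L : Type*}

/-- The vertex at which an end of an internal edge sits: `Sum.inl e` is the end `x = 0` of `e`,
`Sum.inr e` is the end `x = length e`. -/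
def internalVertex (Γ : MetricGraph V E L) : E ⊕ E → V
  | Sum.inl e => Γ.src e
  | Sum.inr e => Γ.tgt e

/-- The vertex at which an edge end sits, for all `2N + M` edge ends. -/
def endVertex (Γ : MetricGraph V E L) : (E ⊕ E) ⊕ L → V
  | Sum.inl h => Γ.internalVertex h
  | Sum.inr s => Γ.lead s

/-- All internal edges have length `ℓ`. -/
def IsEquilateral (Γ : MetricGraph V E L) (ℓ : ℝ) : Prop :=
  ∀ e, Γ.length e = ℓ

/-- Two vertices are neighbours if an internal edge joins them. A vertex that carries a loop is a
neighbour of itself. -/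
def Adj (Γ : MetricGraph V E L) (v w : V) : Prop :=
  ∃ e, (Γ.src e = v ∧ Γ.tgt e = w) ∨ (Γ.src e = w ∧ Γ.tgt e = v)

/-! ### Degrees and balanced vertices -/

section Degree

variable [Fintype E] [Fintype L] [DecidableEq V]

/-- The number of internal edges emanating from `v` (a loop emanates twice). -/
def internalDegree (Γ : MetricGraph V E L) (v : V) : ℕ :=
  Fintype.card {h : E ⊕ E // Γ.internalVertex h = v}

/-- The number of leads attached to `v`. -/
def externalDegree (Γ : MetricGraph V E L) (v : V) : ℕ :=
  Fintype.card {s : L // Γ.lead s = v}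

/-- The degree of `v`. -/
def degree (Γ : MetricGraph V E L) (v : V) : ℕ :=
  Γ.internalDegree v + Γ.externalDegree v

/-- `v` connects the same number of internal and external edges. -/
def IsBalanced (Γ : MetricGraph V E L) (v : V) : Prop :=
  Γ.internalDegree v = Γ.externalDegree v

/-- The number of balanced vertices. -/
def numBalanced (Γ : MetricGraph V E L) : ℕ :=
  Set.ncard {v : V | Γ.IsBalanced v}

/-- The number of balanced vertices that have no balanced neighbour. -/
def numBalancedNonneighbouring (Γ : MetricGraph V E L) : ℕ :=
  Set.ncard {v : V | Γ.IsBalanced v ∧ ∀ w, Γ.Adj v w → ¬ Γ.IsBalanced w}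

end Degree

/-! ### Resonances -/

/-- Standard coupling, for the family `Ψ` of limits of the function values and the family `Ψ'` of
limits of the outgoing derivatives at the edge ends: at every vertex the function is continuous and
the sum of the outgoing derivatives vanishes. -/
def StandardCoupling [Fintype E] [Fintype L] [DecidableEq V] (Γ : MetricGraph V E L)
    (Ψ Ψ' : (E ⊕ E) ⊕ L → ℂ) : Prop :=
  (∀ h h', Γ.endVertex h = Γ.endVertex h' → Ψ h = Ψ h') ∧
    ∀ v : V, ∑ h with Γ.endVertex h = v, Ψ' h = 0

/-- A solution of `-f'' = k² f` on all edges that is `c s * exp (i k x)` on every lead `s`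
(no condition at the vertices is imposed here). The function `df e` is the derivative of the
component `f e`. -/
structure OutgoingSolution (Γ : MetricGraph V E L) (k : ℂ) where
  f : E → ℝ → ℂ
  df : E → ℝ → ℂ
  c : L → ℂ
  hasDeriv : ∀ e, ∀ x ∈ Set.Icc 0 (Γ.length e),
    HasDerivWithinAt (f e) (df e x) (Set.Icc 0 (Γ.length e)) x
  hasDeriv₂ : ∀ e, ∀ x ∈ Set.Icc 0 (Γ.length e),
    HasDerivWithinAt (df e) (-(k ^ 2 * f e x)) (Set.Icc 0 (Γ.length e)) x

namespace OutgoingSolution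

variable {Γ : MetricGraph V E L} {k : ℂ}

/-- The component on the lead `s`. -/
def onLead (u : Γ.OutgoingSolution k) (s : L) (x : ℝ) : ℂ :=
  u.c s * Complex.exp (Complex.I * k * x)

/-- The values at the edge ends. -/
def values (u : Γ.OutgoingSolution k) : (E ⊕ E) ⊕ L → ℂ
  | Sum.inl (Sum.inl e) => u.f e 0
  | Sum.inl (Sum.inr e) => u.f e (Γ.length e)
  | Sum.inr s => u.onLead s 0

/-- The outgoing derivatives at the edge ends (directed from the vertex into the edge). -/
def outgoingDerivs (u : Γ.OutgoingSolution k) : (E ⊕ E) ⊕ L → ℂ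
  | Sum.inl (Sum.inl e) => u.df e 0
  | Sum.inl (Sum.inr e) => -u.df e (Γ.length e)
  | Sum.inr s => deriv (u.onLead s) 0

/-- The solution does not vanish identically on the graph. -/
def IsNonzero (u : Γ.OutgoingSolution k) : Prop :=
  (∃ e, ∃ x ∈ Set.Icc 0 (Γ.length e), u.f e x ≠ 0) ∨ ∃ s, ∃ x : ℝ, 0 ≤ x ∧ u.onLead s x ≠ 0

end OutgoingSolution

section Counting

variable [Fintype E] [Fintype L] [DecidableEq V]

/-- `λ = k²` is a resolvent resonance of the graph with standard coupling: there is a generalized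
eigenfunction that is a multiple of `exp (i k x)` on every lead. -/
def IsResonance (Γ : MetricGraph V E L) (k : ℂ) : Prop :=
  ∃ u : Γ.OutgoingSolution k, u.IsNonzero ∧ Γ.StandardCoupling u.values u.outgoingDerivs

variable [DecidableEq E] [DecidableEq L]

/-- The unitary coupling matrix of the standard coupling: it has the block `(2 / d) J_d - I_d` at a
vertex of degree `d`, and no entries between edge ends at different vertices. -/
def couplingMatrix (Γ : MetricGraph V E L) : Matrix ((E ⊕ E) ⊕ L) ((E ⊕ E) ⊕ L) ℂ :=
  Matrix.of fun h h' =>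
    (if Γ.endVertex h = Γ.endVertex h' then 2 / (Γ.degree (Γ.endVertex h) : ℂ) else 0) -
      (if h = h' then 1 else 0)

/-- The solution `s` of `-s'' = k² s` with `s 0 = 0` and `s' 0 = 1`. -/
def sinSol (k : ℂ) (x : ℝ) : ℂ :=
  if k = 0 then (x : ℂ) else Complex.sin (k * x) / k

/-- The values at the edge ends of the solution with data `y`, that is, of the solution whose
component on the edge `e` has the value `y (inl (inl e))` and the derivative `y (inl (inr e))`
at `x = 0`, and whose component on the lead `s` is `y (inr s) * exp (i k x)`. -/
def dataValues (Γ : MetricGraph V E L) (k : ℂ) (y : (E ⊕ E) ⊕ L → ℂ) : (E ⊕ E) ⊕ L → ℂ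
  | Sum.inl (Sum.inl e) => y (Sum.inl (Sum.inl e))
  | Sum.inl (Sum.inr e) =>
      y (Sum.inl (Sum.inl e)) * Complex.cos (k * Γ.length e) +
        y (Sum.inl (Sum.inr e)) * sinSol k (Γ.length e)
  | Sum.inr s => y (Sum.inr s)

/-- The outgoing derivatives at the edge ends of the solution with data `y`. -/
def dataOutgoingDerivs (Γ : MetricGraph V E L) (k : ℂ) (y : (E ⊕ E) ⊕ L → ℂ) :
    (E ⊕ E) ⊕ L → ℂ
  | Sum.inl (Sum.inl e) => y (Sum.inl (Sum.inr e))
  | Sum.inl (Sum.inr e) =>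
      -(y (Sum.inl (Sum.inl e)) * (-(k * Complex.sin (k * Γ.length e))) +
        y (Sum.inl (Sum.inr e)) * Complex.cos (k * Γ.length e))
  | Sum.inr s => Complex.I * k * y (Sum.inr s)

/-- The left-hand side of the coupling condition `(U - I) Ψ + i (U + I) Ψ' = 0` for the solution
with data `y`. -/
def couplingDefect (Γ : MetricGraph V E L) (k : ℂ) (y : (E ⊕ E) ⊕ L → ℂ) : (E ⊕ E) ⊕ L → ℂ :=
  (Γ.couplingMatrix - 1).mulVec (Γ.dataValues k y) +
    Complex.I • (Γ.couplingMatrix + 1).mulVec (Γ.dataOutgoingDerivs k y)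

/-- The matrix of the linear map `y ↦ couplingDefect k y`. -/
def secularMatrix (Γ : MetricGraph V E L) (k : ℂ) : Matrix ((E ⊕ E) ⊕ L) ((E ⊕ E) ⊕ L) ℂ :=
  Matrix.of fun h j => Γ.couplingDefect k (Pi.single j 1) h

/-- The multiplicity of `k` as a resonance: its order as a zero of the determinant of the linear
system which the coupling conditions impose on the outgoing solutions of `-f'' = k² f`. -/
def multiplicity (Γ : MetricGraph V E L) (k : ℂ) : ℕ∞ :=
  analyticOrderAt (fun z => (Γ.secularMatrix z).det) k

/-- The counting function: the number of resonances, with their multiplicities, in the disc of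
radius `R` in the `k`-plane. -/
def resonanceCount (Γ : MetricGraph V E L) (R : ℝ) : ℝ≥0∞ :=
  ∑' k : {k : ℂ // Γ.IsResonance k ∧ ‖k‖ ≤ R}, (Γ.multiplicity k : ℝ≥0∞)

/-- `W` is the effective size of the graph: the counting function is finite and equal to
`(2 / π) W R + O(1)` as `R → ∞`. -/
def IsEffectiveSize (Γ : MetricGraph V E L) (W : ℝ) : Prop :=
  (∀ R, Γ.resonanceCount R ≠ ∞) ∧
    (fun R : ℝ => (Γ.resonanceCount R).toReal - 2 / Real.pi * W * R) =O[atTop]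
      (fun _ => (1 : ℝ))

end Counting

end MetricGraph

end

namespace MetricGraph

open Matrix Polynomial

variable {V E L : Type*} [Fintype E] [Fintype L] [DecidableEq V] (Γ : MetricGraph V E L)

/-! ### The coupling matrix -/

/-! Let `U` be the coupling matrix, an involution, and let `F` exchange the two ends of every
internal edge. Describe a solution by the amplitudes of the waves leaving the edge ends. A wave
crosses an edge with factor `z = exp (i k ℓ)`, so for `k ≠ 0` the secular determinant is a nowhere
vanishing factor times `det (1 - z S)`, where `S` is the internal block of `U` times `F`
(`det_secularMatrix`). This is the reversed characteristic polynomial of `S` evaluated at `z`.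

Each nonzero root `a` contributes the solutions of `exp (i k ℓ) = a`, an arithmetic progression of
real step `2π/ℓ`, hence `ℓ R / π + O(1)` points in the disc (`expFiber_count`). The point `k = 0`
changes the count by a bounded amount (`resonanceCount_bounds`). So the effective size is exactly
`ℓ/2` times the degree of `det (1 - z S)`, which is `2N` minus the algebraic multiplicity of the
eigenvalue `0` of `S`.

That multiplicity is bounded below by Jordan chains (`numBalanced_add_le_natTrailingDegree`). A
balanced vertex gives a kernel vector of `S`, supported on the ends opposite to that vertex. If the
vertex has no balanced neighbour, this vector also has a preimage under `S`. All these vectors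
together are linearly independent in the generalized kernel. -/

omit [Fintype L] in
theorem card_internalVertex_eq (v : V) :
    (Finset.univ.filter fun h => Γ.internalVertex h = v).card = Γ.internalDegree v := by
  rw [internalDegree, Fintype.card_subtype]

theorem card_endVertex_eq (v : V) :
    (Finset.univ.filter fun h => Γ.endVertex h = v).card = Γ.degree v := by
  rw [degree, internalDegree, externalDegree, ← Fintype.card_sum, ← Fintype.card_subtype]
  refine Fintype.card_congr ?_
  exact Equiv.subtypeSum

theorem degree_endVertex_ne_zero (h : (E ⊕ E) ⊕ L) : (Γ.degree (Γ.endVertex h) : ℂ) ≠ 0 := by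
  rw [← card_endVertex_eq]
  exact_mod_cast Finset.card_ne_zero.2 ⟨h, by simp⟩

variable [DecidableEq E] [DecidableEq L]

theorem couplingMatrix_mulVec (x : (E ⊕ E) ⊕ L → ℂ) (h : (E ⊕ E) ⊕ L) :
    (Γ.couplingMatrix *ᵥ x) h =
      2 / (Γ.degree (Γ.endVertex h) : ℂ) * ∑ j with Γ.endVertex j = Γ.endVertex h, x j - x h := by
  rw [mulVec, dotProduct, Finset.mul_sum, Finset.sum_filter]
  simp only [couplingMatrix, of_apply, sub_mul, Finset.sum_sub_distrib, ite_mul, zero_mul, one_mul,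
    Finset.sum_ite_eq, Finset.mem_univ, if_true, eq_comm (a := Γ.endVertex h)]

/-- At each vertex `U` is `2P - 1` with `P` the averaging projection, that is, a reflection. -/
theorem couplingMatrix_mul_self : Γ.couplingMatrix * Γ.couplingMatrix = 1 := by
  rw [← Matrix.toLin'.injective.eq_iff]
  refine LinearMap.ext fun x => funext fun h => ?_
  rw [toLin'_mul, LinearMap.comp_apply, toLin'_apply, toLin'_apply, toLin'_one,
    LinearMap.id_apply, couplingMatrix_mulVec]
  have key : ∀ j ∈ Finset.univ.filter (fun j => Γ.endVertex j = Γ.endVertex h),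
      (Γ.couplingMatrix *ᵥ x) j = 2 / (Γ.degree (Γ.endVertex h) : ℂ) *
        ∑ i with Γ.endVertex i = Γ.endVertex h, x i - x j := by
    intro j hj
    rw [couplingMatrix_mulVec, (Finset.mem_filter.1 hj).2]
  rw [Finset.sum_congr rfl key, couplingMatrix_mulVec, Finset.sum_sub_distrib, Finset.sum_const,
    card_endVertex_eq, nsmul_eq_mul]
  have := Γ.degree_endVertex_ne_zero h
  field_simp
  ring

/-- Multiplying by `U - 1` kills the derivative term and acts as `-2` on the range of `U - 1`. The
single equation therefore splits into `(U - 1) Ψ = 0`, which is continuity, and `(U + 1) Ψ' = 0`,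
which is the derivative condition. -/
theorem standardCoupling_of_couplingMatrix {Ψ Ψ' : (E ⊕ E) ⊕ L → ℂ}
    (h : (Γ.couplingMatrix - 1) *ᵥ Ψ + Complex.I • (Γ.couplingMatrix + 1) *ᵥ Ψ' = 0) :
    Γ.StandardCoupling Ψ Ψ' := by
  set U := Γ.couplingMatrix with hU
  have hUU : U * U = 1 := Γ.couplingMatrix_mul_self
  have h1 : (U - 1) * (U - 1) = (-2 : ℂ) • (U - 1) := by
    rw [sub_mul, mul_sub, hUU, neg_smul, two_smul]; simp; abel
  have h2 : (U - 1) * (U + 1) = 0 := by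
    rw [sub_mul, mul_add, hUU]; simp; abel
  have h3 : (U - 1) *ᵥ Ψ = 0 := by
    have := congrArg ((U - 1) *ᵥ ·) h
    simp only [mulVec_add, mulVec_smul, mulVec_mulVec, h1, h2, zero_mulVec, smul_zero, add_zero,
      smul_mulVec, mulVec_zero] at this
    simpa using this
  have h4 : (U + 1) *ᵥ Ψ' = 0 := by
    rw [h3, zero_add] at h
    simpa using h
  have h5 : ∀ j, 2 / (Γ.degree (Γ.endVertex j) : ℂ) *
      ∑ i with Γ.endVertex i = Γ.endVertex j, Ψ i = 2 * Ψ j := by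
    intro j
    have := congrFun h3 j
    rw [sub_mulVec, one_mulVec, Pi.sub_apply, hU, couplingMatrix_mulVec, Pi.zero_apply] at this
    linear_combination this
  have h6 : ∀ j, 2 / (Γ.degree (Γ.endVertex j) : ℂ) *
      ∑ i with Γ.endVertex i = Γ.endVertex j, Ψ' i = 0 := by
    intro j
    have := congrFun h4 j
    rw [add_mulVec, one_mulVec, Pi.add_apply, hU, couplingMatrix_mulVec, Pi.zero_apply] at this
    linear_combination this
  refine ⟨fun j j' hj => ?_, fun v => ?_⟩
  · have e1 := h5 j
    rw [hj, h5 j'] at e1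
    exact (mul_left_cancel₀ two_ne_zero e1).symm
  · by_cases hv : ∃ j, Γ.endVertex j = v
    · obtain ⟨j, rfl⟩ := hv
      have := h6 j
      have hd := Γ.degree_endVertex_ne_zero j
      simpa [hd] using this
    · push Not at hv
      simp [hv]

/-! ### Factorization of the secular determinant -/

/-- The matrix that exchanges the two ends of every internal edge. -/
noncomputable def edgeFlip (E : Type*) [DecidableEq E] : Matrix (E ⊕ E) (E ⊕ E) ℂ := fromBlocks 0 1 1 0

/-- The scattering matrix between the internal edges. -/
noncomputable def internalScattering : Matrix (E ⊕ E) (E ⊕ E) ℂ :=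
  Γ.couplingMatrix.toBlocks₁₁ * edgeFlip E

/-- The matrix of `MetricGraph.dataValues` if all edges have length `ℓ`. -/
noncomputable def valuesMatrix (E L : Type*) [DecidableEq E] [DecidableEq L] (ℓ : ℝ) (k : ℂ) :
    Matrix ((E ⊕ E) ⊕ L) ((E ⊕ E) ⊕ L) ℂ :=
  fromBlocks (fromBlocks 1 0 (Complex.cos (k * ℓ) • 1) (sinSol k ℓ • 1)) 0 0 1

/-- The matrix of `MetricGraph.dataOutgoingDerivs` if all edges have length `ℓ`. -/
noncomputable def derivsMatrix (E L : Type*) [DecidableEq E] [DecidableEq L] (ℓ : ℝ) (k : ℂ) :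
    Matrix ((E ⊕ E) ⊕ L) ((E ⊕ E) ⊕ L) ℂ :=
  fromBlocks (fromBlocks 0 1 ((k * Complex.sin (k * ℓ)) • 1) ((-Complex.cos (k * ℓ)) • 1)) 0 0
    ((Complex.I * k) • 1)

/-- The data of the solution with given amplitudes of the waves that emanate from the edge ends. -/
noncomputable def amplitudeMatrix (E L : Type*) [DecidableEq E] [DecidableEq L] (ℓ : ℝ) (k : ℂ) :
    Matrix ((E ⊕ E) ⊕ L) ((E ⊕ E) ⊕ L) ℂ :=
  fromBlocks (fromBlocks 1 (Complex.exp (Complex.I * k * ℓ) • 1) ((Complex.I * k) • 1)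
    ((-(Complex.I * k * Complex.exp (Complex.I * k * ℓ))) • 1)) 0 0 1

variable {Γ} {ℓ : ℝ}

omit [DecidableEq V] in
theorem valuesMatrix_mulVec (hℓ : Γ.IsEquilateral ℓ) (k : ℂ) (y : (E ⊕ E) ⊕ L → ℂ) :
    valuesMatrix E L ℓ k *ᵥ y = Γ.dataValues k y := by
  funext h
  have hℓ' : ∀ e, Γ.length e = ℓ := hℓ
  rcases h with (e | e) | s <;>
    simp [valuesMatrix, dataValues, fromBlocks_mulVec, smul_mulVec, hℓ', mul_comm]

omit [DecidableEq V] in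
theorem derivsMatrix_mulVec (hℓ : Γ.IsEquilateral ℓ) (k : ℂ) (y : (E ⊕ E) ⊕ L → ℂ) :
    derivsMatrix E L ℓ k *ᵥ y = Γ.dataOutgoingDerivs k y := by
  funext h
  have hℓ' : ∀ e, Γ.length e = ℓ := hℓ
  rcases h with (e | e) | s <;>
    simp [derivsMatrix, dataOutgoingDerivs, fromBlocks_mulVec, smul_mulVec, neg_mulVec, hℓ']
  ring

theorem secularMatrix_eq (hℓ : Γ.IsEquilateral ℓ) (k : ℂ) :
    Γ.secularMatrix k = (Γ.couplingMatrix - 1) * valuesMatrix E L ℓ k +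
      Complex.I • ((Γ.couplingMatrix + 1) * derivsMatrix E L ℓ k) := by
  ext h j
  rw [secularMatrix, of_apply, couplingDefect, ← valuesMatrix_mulVec hℓ, ← derivsMatrix_mulVec hℓ,
    mulVec_mulVec, mulVec_mulVec]
  simp [Matrix.smul_apply]

theorem secularMatrix_mulVec (hℓ : Γ.IsEquilateral ℓ) (k : ℂ) (y : (E ⊕ E) ⊕ L → ℂ) :
    Γ.secularMatrix k *ᵥ y = Γ.couplingDefect k y := by
  rw [secularMatrix_eq hℓ, couplingDefect, ← valuesMatrix_mulVec hℓ, ← derivsMatrix_mulVec hℓ,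
    add_mulVec, smul_mulVec, mulVec_mulVec, mulVec_mulVec]

/-- On an edge with amplitudes `a`, `b` the solution is `a exp (i k x) + b exp (i k (ℓ - x))`: each
end sees its own wave plus the one from the other end, delayed by `exp (i k ℓ)`. In the outgoing
derivatives the arriving wave changes sign. -/
theorem valuesMatrix_mul_amplitudeMatrix {k : ℂ} (hk : k ≠ 0) :
    valuesMatrix E L ℓ k * amplitudeMatrix E L ℓ k =
      1 + Complex.exp (Complex.I * k * ℓ) • fromBlocks (edgeFlip E) 0 0 0 := by
  have e : Complex.I * k * ℓ = (k * ℓ) * Complex.I := by ring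
  have hs := Complex.cos_sq_add_sin_sq (k * ℓ)
  have h1 : Complex.cos (k * ℓ) + Complex.sin (k * ℓ) / k * (Complex.I * k) =
      Complex.cos (k * ℓ) + Complex.sin (k * ℓ) * Complex.I := by
    field_simp
  have h2 : Complex.cos (k * ℓ) * (Complex.cos (k * ℓ) + Complex.sin (k * ℓ) * Complex.I) -
      Complex.sin (k * ℓ) / k *
        (Complex.I * k * (Complex.cos (k * ℓ) + Complex.sin (k * ℓ) * Complex.I)) = 1 := by
    field_simp
    linear_combination hs - (Complex.sin (k * ℓ)) ^ 2 * Complex.I_sq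
  simp only [valuesMatrix, amplitudeMatrix, edgeFlip, fromBlocks_multiply, ← fromBlocks_one,
    fromBlocks_smul, fromBlocks_add, fromBlocks_inj, sinSol, if_neg hk, e, Complex.exp_mul_I]
  simp only [Matrix.mul_one, Matrix.one_mul, Matrix.mul_zero, Matrix.zero_mul, add_zero, zero_add,
    smul_mul_smul_comm, smul_zero, and_self, ← add_smul,
    mul_neg, ← sub_eq_add_neg, h1, h2, one_smul]

theorem derivsMatrix_mul_amplitudeMatrix (k : ℂ) :
    derivsMatrix E L ℓ k * amplitudeMatrix E L ℓ k =
      (Complex.I * k) • (1 - Complex.exp (Complex.I * k * ℓ) • fromBlocks (edgeFlip E) 0 0 0) := by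
  have e : Complex.I * k * ℓ = (k * ℓ) * Complex.I := by ring
  have hs := Complex.cos_sq_add_sin_sq (k * ℓ)
  have h1 : k * Complex.sin (k * ℓ) - Complex.cos (k * ℓ) * (Complex.I * k) =
      -(Complex.I * k * (Complex.cos (k * ℓ) + Complex.sin (k * ℓ) * Complex.I)) := by
    linear_combination (k * Complex.sin (k * ℓ)) * Complex.I_sq
  have h2 : k * Complex.sin (k * ℓ) *
        (Complex.cos (k * ℓ) + Complex.sin (k * ℓ) * Complex.I) + Complex.cos (k * ℓ) *
        (Complex.I * k * (Complex.cos (k * ℓ) + Complex.sin (k * ℓ) * Complex.I)) =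
      Complex.I * k := by
    linear_combination (Complex.I * k) * hs +
      (k * Complex.sin (k * ℓ) * Complex.cos (k * ℓ)) * Complex.I_sq
  simp only [derivsMatrix, amplitudeMatrix, edgeFlip, fromBlocks_multiply, ← fromBlocks_one,
    fromBlocks_smul, sub_eq_add_neg, fromBlocks_neg, fromBlocks_add, fromBlocks_inj, e,
    Complex.exp_mul_I]
  simp only [Matrix.mul_one, Matrix.one_mul, Matrix.mul_zero, Matrix.zero_mul, add_zero, zero_add,
    smul_mul_smul_comm, smul_zero, neg_zero, and_self, ← add_smul, smul_smul,
    neg_mul, mul_neg, neg_neg, ← neg_smul, ← sub_eq_add_neg, h1, h2]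

theorem det_amplitudeMatrix (k : ℂ) :
    (amplitudeMatrix E L ℓ k).det =
      (-2 * (Complex.I * k * Complex.exp (Complex.I * k * ℓ))) ^ Fintype.card E := by
  rw [amplitudeMatrix, det_fromBlocks_zero₁₂, det_fromBlocks_one₁₁, det_one, mul_one]
  rw [smul_mul_smul_comm, one_mul, ← sub_smul, det_smul, det_one, mul_one]
  congr 1
  ring

variable (Γ) in
-- Nothing arrives from the leads, so the lead columns of the product vanish. The matrix is block
-- triangular and only the internal block contributes.
theorem det_one_sub_smul (z : ℂ) :
    (1 - z • (Γ.couplingMatrix * fromBlocks (edgeFlip E) 0 0 0)).det =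
      Γ.internalScattering.charpolyRev.eval z := by
  rw [← fromBlocks_toBlocks Γ.couplingMatrix, fromBlocks_multiply, ← fromBlocks_one,
    fromBlocks_smul, sub_eq_add_neg, fromBlocks_neg, fromBlocks_add]
  simp only [Matrix.mul_zero, add_zero, smul_zero, neg_zero]
  rw [det_fromBlocks_zero₁₂, det_one, mul_one, charpolyRev, ← coe_evalRingHom, RingHom.map_det]
  change _ = (RingHom.mapMatrix (evalRingHom z) _).det
  congr 1
  ext i j
  rw [RingHom.mapMatrix_apply, Matrix.map_apply, coe_evalRingHom, Matrix.add_apply,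
    Matrix.neg_apply, Matrix.smul_apply, Matrix.sub_apply, Matrix.smul_apply, Matrix.map_apply,
    one_apply, one_apply, internalScattering]
  split_ifs <;> simp [-Matrix.map_mul, sub_eq_add_neg, mul_comm z]

variable (Γ) in
/-- The part of the secular determinant without zeros outside of the origin. -/
noncomputable def secularFactor (ℓ : ℝ) (k : ℂ) : ℂ :=
  (Γ.couplingMatrix - 1 - k • (Γ.couplingMatrix + 1)).det /
    (-2 * (Complex.I * k * Complex.exp (Complex.I * k * ℓ))) ^ Fintype.card E

/-- On the eigenspaces of `U` for `1` and `-1` the matrix in the numerator acts as `-2k` and `-2`.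
Its product with the same matrix at `k⁻¹` is therefore `4`. -/
theorem secularFactor_ne_zero {k : ℂ} (hk : k ≠ 0) : Γ.secularFactor ℓ k ≠ 0 := by
  refine div_ne_zero ?_ (by simp [hk])
  set U := Γ.couplingMatrix with hU
  have hUU : U * U = 1 := Γ.couplingMatrix_mul_self
  have h : (U - 1 - k • (U + 1)) * (U - 1 - k⁻¹ • (U + 1)) = (4 : ℂ) • 1 := by
    simp only [sub_mul, mul_sub, add_mul, mul_add, smul_mul_assoc, mul_smul_comm, smul_smul,
      smul_sub, smul_add, hUU, mul_one, one_mul, inv_mul_cancel₀ hk, one_smul]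
    module
  intro h0
  have := congrArg det h
  rw [det_mul, h0, zero_mul, det_smul, det_one, mul_one] at this
  exact pow_ne_zero _ (by norm_num) this.symm

/-- In amplitudes the system is `(U - 1)(1 + zF) - k (U + 1)(1 - zF)`, with `F` extended by zero to
the leads. Since `U² = 1` gives `(U - 1) U = -(U - 1)` and `(U + 1) U = U + 1`, this equals `(U - 1
- k (U + 1))(1 - z U F)`. -/
theorem det_secularMatrix (hℓ : Γ.IsEquilateral ℓ) {k : ℂ} (hk : k ≠ 0) :
    (Γ.secularMatrix k).det = Γ.secularFactor ℓ k *
      Γ.internalScattering.charpolyRev.eval (Complex.exp (Complex.I * k * ℓ)) := by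
  have hT : (-2 * (Complex.I * k * Complex.exp (Complex.I * k * ℓ))) ^ Fintype.card E ≠ 0 := by
    simp [hk]
  rw [secularFactor, div_mul_eq_mul_div, eq_div_iff hT, ← det_amplitudeMatrix (L := L), ← det_mul,
    ← det_one_sub_smul, ← det_mul]
  congr 1
  rw [secularMatrix_eq hℓ, add_mul, Matrix.mul_assoc, valuesMatrix_mul_amplitudeMatrix hk,
    smul_mul_assoc, Matrix.mul_assoc, derivsMatrix_mul_amplitudeMatrix]
  have hUU : Γ.couplingMatrix * Γ.couplingMatrix = 1 := Γ.couplingMatrix_mul_self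
  generalize Γ.couplingMatrix = U at *
  generalize (fromBlocks (edgeFlip E) 0 0 0 : Matrix ((E ⊕ E) ⊕ L) ((E ⊕ E) ⊕ L) ℂ) = S
  have h1 : U * (U * S) = S := by rw [← mul_assoc, hUU, one_mul]
  have hI : Complex.I * (Complex.I * k) = -k := by
    rw [← mul_assoc, Complex.I_mul_I]; ring
  rw [mul_smul_comm, smul_smul, hI]
  simp only [sub_mul, mul_sub, add_mul, mul_add, smul_mul_assoc, mul_smul_comm, smul_smul,
    smul_sub, smul_add, h1, mul_one, one_mul]
  module

end MetricGraph

namespace MetricGraph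

open Matrix Polynomial

variable {V E L : Type*} [Fintype E] [Fintype L] [DecidableEq V] [DecidableEq E] [DecidableEq L]
  (Γ : MetricGraph V E L)

/-! ### The generalized kernel of the internal scattering matrix -/

omit [Fintype L] [DecidableEq L] in
theorem edgeFlip_mulVec (x : E ⊕ E → ℂ) (h : E ⊕ E) : (edgeFlip E *ᵥ x) h = x h.swap := by
  rcases h with e | e <;> simp [edgeFlip, fromBlocks_mulVec]

theorem internalScattering_mulVec (x : E ⊕ E → ℂ) (h : E ⊕ E) :
    (Γ.internalScattering *ᵥ x) h = 2 / (Γ.degree (Γ.internalVertex h) : ℂ) *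
      ∑ j with Γ.internalVertex j = Γ.internalVertex h, x j.swap - x h.swap := by
  rw [internalScattering, ← mulVec_mulVec, mulVec, dotProduct, Finset.mul_sum, Finset.sum_filter]
  simp only [edgeFlip_mulVec, toBlocks₁₁, couplingMatrix, endVertex, of_apply, sub_mul,
    Finset.sum_sub_distrib, ite_mul, zero_mul, one_mul, Sum.inl.injEq,
    Finset.sum_ite_eq, Finset.mem_univ, if_true, eq_comm (a := Γ.internalVertex h)]

/-- The indicator of the edge ends that are opposite to the edge ends at `v`. -/
def oppositeIndicator (v : V) (h : E ⊕ E) : ℂ := if Γ.internalVertex h.swap = v then 1 else 0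

/-- A preimage of `oppositeIndicator v` under the internal scattering matrix, if `v` has no
balanced neighbour. In the ends at a vertex with `p` internal and `q` external
edges the scattering matrix has the block `(2 / (p + q)) J - I`, whose inverse is
`(2 / (p - q)) J - I` unless `p = q`. -/
noncomputable def oppositePreimage (v : V) (h : E ⊕ E) : ℂ :=
  2 / ((Γ.internalDegree (Γ.internalVertex h.swap) : ℂ) -
      Γ.externalDegree (Γ.internalVertex h.swap)) *
    (∑ j with Γ.internalVertex j = Γ.internalVertex h.swap, Γ.oppositeIndicator v j) -
    Γ.oppositeIndicator v h.swap

omit [Fintype L] [DecidableEq E] [DecidableEq L] in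
theorem internalDegree_ne_zero (h : E ⊕ E) : Γ.internalDegree (Γ.internalVertex h) ≠ 0 := by
  rw [← card_internalVertex_eq]
  exact Finset.card_ne_zero.2 ⟨h, by simp⟩

/-- The flip turns the vector into the constant `1` on the `p` internal ends at `v`. Balance makes
the degree `2p`, so the block sends it to `2p / (2p) - 1 = 0`. -/
theorem internalScattering_mulVec_oppositeIndicator {v : V} (hv : Γ.IsBalanced v) :
    Γ.internalScattering *ᵥ Γ.oppositeIndicator v = 0 := by
  funext h
  rw [internalScattering_mulVec]
  simp only [oppositeIndicator, Sum.swap_swap, Pi.zero_apply]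
  by_cases hh : Γ.internalVertex h = v
  · have h1 : ∑ j with Γ.internalVertex j = Γ.internalVertex h,
        (if Γ.internalVertex j = v then (1 : ℂ) else 0) = Γ.internalDegree v := by
      rw [← card_internalVertex_eq, Finset.card_eq_sum_ones, Nat.cast_sum, hh]
      refine Finset.sum_congr rfl fun j hj => ?_
      simp [(Finset.mem_filter.1 hj).2]
    have h2 : (Γ.internalDegree v : ℂ) ≠ 0 := by
      exact_mod_cast hh ▸ Γ.internalDegree_ne_zero h
    rw [h1, if_pos hh, hh, degree, ← (show _ = _ from hv)]
    push_cast
    field_simp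
    ring
  · rw [Finset.sum_eq_zero, if_neg hh]
    · simp
    · intro j hj
      rw [(Finset.mem_filter.1 hj).2, if_neg hh]

theorem internalScattering_mulVec_oppositePreimage {v : V}
    (hv' : ∀ w, Γ.Adj v w → ¬ Γ.IsBalanced w) :
    Γ.internalScattering *ᵥ Γ.oppositePreimage v = Γ.oppositeIndicator v := by
  funext h
  rw [internalScattering_mulVec]
  simp only [oppositePreimage, Sum.swap_swap]
  set G := ∑ j with Γ.internalVertex j = Γ.internalVertex h, Γ.oppositeIndicator v j with hG
  have key : ∀ j ∈ Finset.univ.filter (fun j => Γ.internalVertex j = Γ.internalVertex h),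
      (2 / ((Γ.internalDegree (Γ.internalVertex j) : ℂ) - Γ.externalDegree (Γ.internalVertex j)) *
        (∑ i with Γ.internalVertex i = Γ.internalVertex j, Γ.oppositeIndicator v i) -
        Γ.oppositeIndicator v j) =
      (2 / ((Γ.internalDegree (Γ.internalVertex h) : ℂ) - Γ.externalDegree (Γ.internalVertex h)) *
        G - Γ.oppositeIndicator v j) := by
    intro j hj
    rw [(Finset.mem_filter.1 hj).2]
  rw [Finset.sum_congr rfl key, Finset.sum_sub_distrib, Finset.sum_const, card_internalVertex_eq,
    nsmul_eq_mul, ← hG, degree]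
  -- At a balanced vertex the block is not invertible and the coefficient `2 / (p - q)` is `2 / 0 =
  -- 0`. This is harmless: such a vertex is not a neighbour of `v`, so the sum `G` vanishes and the
  -- block acts as `-1`.
  by_cases hb : Γ.IsBalanced (Γ.internalVertex h)
  · have hG0 : G = 0 := by
      refine Finset.sum_eq_zero fun j hj => if_neg fun hj' => ?_
      have hj := (Finset.mem_filter.1 hj).2
      refine hv' _ ?_ (hj ▸ hb)
      rcases j with e | e
      · exact ⟨e, Or.inr ⟨rfl, hj'⟩⟩
      · exact ⟨e, Or.inl ⟨hj', rfl⟩⟩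
    rw [hG0]
    ring
  · have h1 : (Γ.internalDegree (Γ.internalVertex h) : ℂ) -
        Γ.externalDegree (Γ.internalVertex h) ≠ 0 := by
      rw [sub_ne_zero]
      exact_mod_cast hb
    have h2 : (Γ.internalDegree (Γ.internalVertex h) : ℂ) +
        Γ.externalDegree (Γ.internalVertex h) ≠ 0 := by
      have := Γ.internalDegree_ne_zero h
      exact_mod_cast (by omega)
    push_cast
    field_simp
    ring

omit [Fintype E] [Fintype L] [DecidableEq E] [DecidableEq L] in
-- The supports for different vertices are disjoint, so one entry of a combination reads off one
-- coefficient.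
theorem sum_mul_oppositeIndicator [Fintype V] {p : V → Prop} [DecidablePred p]
    (g : {v // p v} → ℂ) (h : E ⊕ E) :
    (∑ v, g v • Γ.oppositeIndicator (v : V)) h.swap =
      if hh : p (Γ.internalVertex h) then g ⟨_, hh⟩ else 0 := by
  rw [Finset.sum_apply]
  simp only [Pi.smul_apply, oppositeIndicator, Sum.swap_swap, smul_eq_mul, mul_ite, mul_one,
    mul_zero]
  split_ifs with hh
  · rw [Finset.sum_eq_single ⟨_, hh⟩] <;> simp +contextual [Subtype.ext_iff, eq_comm]
  · refine Finset.sum_eq_zero fun v _ => if_neg fun e => hh (by rw [e]; exact v.2)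

omit [DecidableEq E] [DecidableEq L] in
-- Positive degree enters here: an isolated vertex would count as balanced, but its indicator would
-- be zero.
theorem exists_internalVertex_eq {v : V} (hdeg : 0 < Γ.degree v) (hv : Γ.IsBalanced v) :
    ∃ h, Γ.internalVertex h = v := by
  have h0 : 0 < Γ.internalDegree v := by
    have : Γ.internalDegree v = Γ.externalDegree v := hv
    rw [degree] at hdeg
    omega
  rw [← card_internalVertex_eq, Finset.card_pos] at h0
  obtain ⟨h, hh⟩ := h0
  exact ⟨h, (Finset.mem_filter.1 hh).2⟩

omit [DecidableEq E] [DecidableEq L] in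
theorem linearIndependent_oppositeIndicator [Fintype V] (hdeg : ∀ v, 0 < Γ.degree v)
    {p : V → Prop} (hp : ∀ v, p v → Γ.IsBalanced v) :
    LinearIndependent ℂ fun v : {v // p v} => Γ.oppositeIndicator (v : V) := by
  classical
  rw [Fintype.linearIndependent_iff]
  rintro g hg ⟨v, hv⟩
  obtain ⟨h, rfl⟩ := Γ.exists_internalVertex_eq (hdeg v) (hp v hv)
  have := congrFun hg h.swap
  rwa [sum_mul_oppositeIndicator, dif_pos hv] at this

/-- The trailing degree of the characteristic polynomial is the dimension of the generalized kernel,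
which contains chains preimage ↦ indicator ↦ `0`. -/
theorem numBalanced_add_le_natTrailingDegree [Fintype V] (hdeg : ∀ v, 0 < Γ.degree v) :
    Γ.numBalanced + Γ.numBalancedNonneighbouring ≤
      Γ.internalScattering.charpoly.natTrailingDegree := by
  classical
  set f : Module.End ℂ (E ⊕ E → ℂ) := toLin' Γ.internalScattering with hf
  have hcard : Γ.numBalanced + Γ.numBalancedNonneighbouring = Fintype.card
      ({v // Γ.IsBalanced v} ⊕ {v // Γ.IsBalanced v ∧ ∀ w, Γ.Adj v w → ¬ Γ.IsBalanced w}) := by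
    rw [Fintype.card_sum, numBalanced, numBalancedNonneighbouring, ← Nat.card_coe_set_eq,
      ← Nat.card_coe_set_eq, Nat.card_eq_fintype_card, Nat.card_eq_fintype_card]
    rfl
  have hf1 : ∀ v, Γ.IsBalanced v → f (Γ.oppositeIndicator v) = 0 := fun v hv =>
    Γ.internalScattering_mulVec_oppositeIndicator hv
  have hf2 : ∀ v, (Γ.IsBalanced v ∧ ∀ w, Γ.Adj v w → ¬ Γ.IsBalanced w) →
      f (Γ.oppositePreimage v) = Γ.oppositeIndicator v := fun v hv =>
    Γ.internalScattering_mulVec_oppositePreimage hv.2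
  have hmem1 : ∀ v, Γ.IsBalanced v → Γ.oppositeIndicator v ∈ f.maxGenEigenspace 0 := by
    intro v hv
    rw [Module.End.mem_maxGenEigenspace]
    exact ⟨1, by simpa using hf1 v hv⟩
  have hmem2 : ∀ v, (Γ.IsBalanced v ∧ ∀ w, Γ.Adj v w → ¬ Γ.IsBalanced w) →
      Γ.oppositePreimage v ∈ f.maxGenEigenspace 0 := by
    intro v hv
    rw [Module.End.mem_maxGenEigenspace]
    refine ⟨2, ?_⟩
    rw [zero_smul, sub_zero, pow_two, Module.End.mul_apply, hf2 v hv, hf1 v hv.1]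
  have hli : LinearIndependent ℂ (Sum.elim
      (fun v : {v // Γ.IsBalanced v} =>
        (⟨_, hmem1 v v.2⟩ : f.maxGenEigenspace 0))
      (fun v : {v // Γ.IsBalanced v ∧ ∀ w, Γ.Adj v w → ¬ Γ.IsBalanced w} =>
        (⟨_, hmem2 v v.2⟩ : f.maxGenEigenspace 0))) := by
    rw [Fintype.linearIndependent_iff]
    intro g hg
    have hg' := congrArg Subtype.val hg
    simp only [Fintype.sum_sum_type, Sum.elim_inl, Sum.elim_inr, Submodule.coe_add,
      Submodule.coe_sum, Submodule.coe_smul, ZeroMemClass.coe_zero] at hg'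
    have h1 := Fintype.linearIndependent_iff.1
      (Γ.linearIndependent_oppositeIndicator hdeg (p := fun v => Γ.IsBalanced v) fun _ h => h)
    have h2 := Fintype.linearIndependent_iff.1
      (Γ.linearIndependent_oppositeIndicator hdeg
        (p := fun v => Γ.IsBalanced v ∧ ∀ w, Γ.Adj v w → ¬ Γ.IsBalanced w) fun _ h => h.1)
    -- Applying `f` kills the indicators and turns the preimages into indicators, whose independence
    -- is known.
    have h3 : ∀ v, g (Sum.inr v) = 0 := by
      refine h2 _ ?_
      have := congrArg f hg'
      rw [map_add, map_sum, map_sum, map_zero] at this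
      rw [Finset.sum_eq_zero, zero_add] at this
      · rw [← this]
        exact Finset.sum_congr rfl fun v _ => by rw [map_smul, hf2 v v.2]
      · intro v _
        rw [map_smul, hf1 v v.2, smul_zero]
    have h4 : ∀ v, g (Sum.inl v) = 0 := by
      refine h1 _ ?_
      simpa [h3] using hg'
    rintro (v | v)
    · exact h4 v
    · exact h3 v
  have := hli.fintype_card_le_finrank
  rwa [← hcard, LinearMap.finrank_maxGenEigenspace_zero_eq, hf, charpoly_toLin'] at this

/-- Reversing a polynomial lowers its degree by the order of its zero at the origin. -/
theorem natDegree_charpolyRev_add_le [Fintype V] (hdeg : ∀ v, 0 < Γ.degree v) :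
    Γ.internalScattering.charpolyRev.natDegree + Γ.numBalanced + Γ.numBalancedNonneighbouring ≤
      2 * Fintype.card E := by
  have h1 := Γ.numBalanced_add_le_natTrailingDegree hdeg
  have h2 := Γ.internalScattering.charpoly.natDegree_eq_reverse_natDegree_add_natTrailingDegree
  rw [charpoly_natDegree_eq_dim, reverse_charpoly, Fintype.card_sum] at h2
  omega

end MetricGraph

namespace MetricGraph

open Matrix Polynomial

variable {V E L : Type*} {Γ : MetricGraph V E L} {ℓ : ℝ}

/-! ### Zeros of the secular determinant are resonances -/

/-- The solution with the data `y`, as in `MetricGraph.dataValues`. -/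
noncomputable def dataSolution (Γ : MetricGraph V E L) {k : ℂ} (hk : k ≠ 0)
    (y : (E ⊕ E) ⊕ L → ℂ) : Γ.OutgoingSolution k where
  f e x := y (Sum.inl (Sum.inl e)) * Complex.cos (k * x) + y (Sum.inl (Sum.inr e)) * sinSol k x
  df e x := y (Sum.inl (Sum.inl e)) * (-(k * Complex.sin (k * x))) +
    y (Sum.inl (Sum.inr e)) * Complex.cos (k * x)
  c s := y (Sum.inr s)
  hasDeriv e x _ := by
    have h0 : HasDerivAt (fun z : ℂ => k * z) k (x : ℂ) := by
      simpa using (hasDerivAt_id (x : ℂ)).const_mul k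
    have h1 := ((h0.ccos.const_mul (y (Sum.inl (Sum.inl e)))).add
      ((h0.csin.div_const k).const_mul (y (Sum.inl (Sum.inr e))))).comp_ofReal
    simp only [sinSol, if_neg hk]
    refine HasDerivAt.hasDerivWithinAt (h1.congr_deriv ?_)
    field_simp
  hasDeriv₂ e x _ := by
    have h0 : HasDerivAt (fun z : ℂ => k * z) k (x : ℂ) := by
      simpa using (hasDerivAt_id (x : ℂ)).const_mul k
    have h1 := (((h0.csin.const_mul k).neg.const_mul (y (Sum.inl (Sum.inl e)))).add
      (h0.ccos.const_mul (y (Sum.inl (Sum.inr e))))).comp_ofReal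
    simp only [sinSol, if_neg hk]
    refine HasDerivAt.hasDerivWithinAt (h1.congr_deriv ?_)
    field_simp
    ring

theorem values_dataSolution {k : ℂ} (hk : k ≠ 0) (y : (E ⊕ E) ⊕ L → ℂ) :
    (Γ.dataSolution hk y).values = Γ.dataValues k y := by
  funext h
  rcases h with (e | e) | s <;>
    simp [dataSolution, OutgoingSolution.values, dataValues, OutgoingSolution.onLead, sinSol, hk]

theorem outgoingDerivs_dataSolution {k : ℂ} (hk : k ≠ 0) (y : (E ⊕ E) ⊕ L → ℂ) :
    (Γ.dataSolution hk y).outgoingDerivs = Γ.dataOutgoingDerivs k y := by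
  funext h
  rcases h with (e | e) | s
  · simp [dataSolution, OutgoingSolution.outgoingDerivs, dataOutgoingDerivs]
  · simp [dataSolution, OutgoingSolution.outgoingDerivs, dataOutgoingDerivs]
  · have h0 : HasDerivAt (fun z : ℂ => Complex.I * k * z) (Complex.I * k) ((0 : ℝ) : ℂ) := by
      simpa using (hasDerivAt_id ((0 : ℝ) : ℂ)).const_mul (Complex.I * k)
    have h1 := (h0.cexp.const_mul (y (Sum.inr s))).comp_ofReal
    have h2 : deriv ((Γ.dataSolution hk y).onLead s) 0 = _ := h1.deriv
    simp only [OutgoingSolution.outgoingDerivs, dataOutgoingDerivs, h2]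
    simp [mul_comm]

theorem isNonzero_dataSolution {k : ℂ} (hk : k ≠ 0) {y : (E ⊕ E) ⊕ L → ℂ} (hy : y ≠ 0) :
    (Γ.dataSolution hk y).IsNonzero := by
  by_contra hn
  simp only [OutgoingSolution.IsNonzero, not_or, not_exists, not_and, not_not] at hn
  obtain ⟨hE, hL⟩ := hn
  refine hy (funext fun h => ?_)
  rcases h with (e | e) | s
  · simpa [dataSolution, sinSol, hk] using hE e 0 ⟨le_rfl, (Γ.length_pos e).le⟩
  -- The remaining datum is the derivative at `0`, which vanishes because the component vanishes on
  -- an interval of positive length.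
  · have hm : (0 : ℝ) ∈ Set.Icc 0 (Γ.length e) := ⟨le_rfl, (Γ.length_pos e).le⟩
    have h1 := (Γ.dataSolution hk y).hasDeriv e 0 hm
    have h2 : HasDerivWithinAt ((Γ.dataSolution hk y).f e) 0 (Set.Icc 0 (Γ.length e)) 0 :=
      (hasDerivWithinAt_const 0 _ (0 : ℂ)).congr (fun x hx => hE e x hx) (hE e 0 hm)
    have h3 := (uniqueDiffOn_Icc (Γ.length_pos e) 0 hm).eq_deriv _ h1 h2
    simpa [dataSolution] using h3
  · simpa [dataSolution, OutgoingSolution.onLead] using hL s 0 le_rfl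

/-- This direction suffices for counting: a resonance at which the determinant does not vanish has
multiplicity `0` and adds nothing. -/
theorem isResonance_of_det_eq_zero [Fintype E] [Fintype L] [DecidableEq V] [DecidableEq E]
    [DecidableEq L] (hℓ : Γ.IsEquilateral ℓ) {k : ℂ} (hk : k ≠ 0)
    (hdet : (Γ.secularMatrix k).det = 0) : Γ.IsResonance k := by
  obtain ⟨y, hy, hy'⟩ := exists_mulVec_eq_zero_iff.2 hdet
  refine ⟨Γ.dataSolution hk y, isNonzero_dataSolution hk hy, ?_⟩
  rw [values_dataSolution, outgoingDerivs_dataSolution]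
  refine Γ.standardCoupling_of_couplingMatrix ?_
  rwa [secularMatrix_mulVec hℓ] at hy'

end MetricGraph

/-! ### Order of vanishing of a polynomial function -/

open Polynomial in
theorem Polynomial.analyticOrderAt_eval {p : ℂ[X]} (hp : p ≠ 0) (z : ℂ) :
    analyticOrderAt (fun w => p.eval w) z = p.rootMultiplicity z := by
  have han : ∀ q : ℂ[X], AnalyticAt ℂ (fun w => q.eval w) z := fun q => by
    simpa using AnalyticAt.aeval_polynomial (analyticAt_id (𝕜 := ℂ) (z := z)) q
  obtain ⟨q, hq, hq'⟩ := exists_eq_pow_rootMultiplicity_mul_and_not_dvd p hp z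
  rw [(han p).analyticOrderAt_eq_natCast]
  refine ⟨fun w => q.eval w, han q, fun h => hq' (dvd_iff_isRoot.2 h), Eventually.of_forall ?_⟩
  intro w
  conv_lhs => rw [hq]
  simp

/-! ### Counting logarithms in a disc -/

/-- The points `k` of the disc of radius `R` with `exp (i k ℓ) = a`. -/
def expFiber (ℓ : ℝ) (a : ℂ) (R : ℝ) : Set ℂ :=
  {k | ‖k‖ ≤ R ∧ Complex.exp (Complex.I * k * ℓ) = a}

theorem exists_expFiber_eq_image {ℓ : ℝ} (hℓ : ℓ ≠ 0) {a : ℂ} (ha : a ≠ 0) :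
    ∃ k₀ : ℂ, ∀ R, expFiber ℓ a R =
      (fun n : ℤ => k₀ + (n * (2 * Real.pi / ℓ) : ℝ)) ''
        {n : ℤ | ‖k₀ + (n * (2 * Real.pi / ℓ) : ℝ)‖ ≤ R} := by
  have hℓ' : (ℓ : ℂ) ≠ 0 := by exact_mod_cast hℓ
  refine ⟨-Complex.I * Complex.log a / ℓ, fun R => ?_⟩
  have key : ∀ k, Complex.exp (Complex.I * k * ℓ) = a ↔
      ∃ n : ℤ, -Complex.I * Complex.log a / ℓ + ((n * (2 * Real.pi / ℓ) : ℝ) : ℂ) = k := by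
    intro k
    conv_lhs => rw [← Complex.exp_log ha, Complex.exp_eq_exp_iff_exists_int]
    refine exists_congr fun n => ⟨fun h => ?_, fun h => ?_⟩
    · push_cast
      field_simp
      linear_combination (Complex.I) * h - (k * ℓ - n * 2 * Real.pi) * Complex.I_sq
    · rw [← h]
      push_cast
      field_simp
      linear_combination (-Complex.log a) * Complex.I_sq
  ext k
  simp only [expFiber, Set.mem_ofPred_eq, key, Set.mem_image]
  constructor
  · rintro ⟨h, n, rfl⟩
    exact ⟨n, h, rfl⟩
  · rintro ⟨n, h, rfl⟩
    exact ⟨h, n, rfl⟩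

theorem ncard_abs_le {x : ℝ} (hx : 0 ≤ x) :
    (Set.ncard {n : ℤ | |(n : ℝ)| ≤ x} : ℝ) = 2 * ⌊x⌋ + 1 ∧ {n : ℤ | |(n : ℝ)| ≤ x}.Finite := by
  have h : {n : ℤ | |(n : ℝ)| ≤ x} = ((Finset.Icc (-⌊x⌋) ⌊x⌋ : Finset ℤ) : Set ℤ) := by
    ext n
    simp only [Set.mem_ofPred_eq, abs_le, Finset.coe_Icc, Set.mem_Icc, Int.le_floor]
    rw [neg_le (a := ⌊x⌋), Int.le_floor, neg_le (b := (n : ℝ)), Int.cast_neg]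
  rw [h, Set.ncard_coe_finset, Int.card_Icc]
  refine ⟨?_, Finset.finite_toSet _⟩
  have h0 : 0 ≤ ⌊x⌋ := Int.floor_nonneg.2 hx
  have : ((⌊x⌋ + 1 - -⌊x⌋).toNat : ℤ) = 2 * ⌊x⌋ + 1 := by
    rw [Int.toNat_of_nonneg (by omega)]; ring
  exact_mod_cast this

/-- With step `t = 2π/ℓ`, the index set lies between those of `|n| t ≤ R - ‖k₀‖` and `|n| t ≤ R +
‖k₀‖`. Both have `2R/t + O(1)` elements. -/
theorem expFiber_count {ℓ : ℝ} (hℓ : 0 < ℓ) {a : ℂ} (ha : a ≠ 0) :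
    (∀ R, (expFiber ℓ a R).Finite) ∧
      ∃ C : ℝ, ∀ᶠ R : ℝ in atTop, |((expFiber ℓ a R).ncard : ℝ) - ℓ / Real.pi * R| ≤ C := by
  obtain ⟨k₀, hk₀⟩ := exists_expFiber_eq_image hℓ.ne' ha
  have hπ := Real.pi_pos
  set t : ℝ := 2 * Real.pi / ℓ with ht
  have htpos : 0 < t := by positivity
  have hnorm : ∀ n : ℤ, ‖((n * t : ℝ) : ℂ)‖ = |(n : ℝ)| * t := by
    intro n
    rw [Complex.norm_real, Real.norm_eq_abs, abs_mul, abs_of_pos htpos]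
  have hinj : Function.Injective fun n : ℤ => k₀ + ((n * t : ℝ) : ℂ) := by
    intro m n h
    have h1 : (m * t : ℝ) = n * t := by exact_mod_cast add_left_cancel h
    exact_mod_cast mul_right_cancel₀ htpos.ne' h1
  have hsub : ∀ R, {n : ℤ | ‖k₀ + ((n * t : ℝ) : ℂ)‖ ≤ R} ⊆
      {n : ℤ | |(n : ℝ)| ≤ (R + ‖k₀‖) / t} := by
    intro R n hn
    have h1 : ‖((n * t : ℝ) : ℂ)‖ ≤ ‖k₀ + ((n * t : ℝ) : ℂ)‖ + ‖k₀‖ := by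
      simpa using norm_sub_le (k₀ + ((n * t : ℝ) : ℂ)) k₀
    rw [hnorm] at h1
    simp only [Set.mem_ofPred_eq] at hn ⊢
    rw [le_div_iff₀ htpos]
    linarith
  have hsup : ∀ R, {n : ℤ | |(n : ℝ)| ≤ (R - ‖k₀‖) / t} ⊆
      {n : ℤ | ‖k₀ + ((n * t : ℝ) : ℂ)‖ ≤ R} := by
    intro R n hn
    have h1 := norm_add_le k₀ ((n * t : ℝ) : ℂ)
    rw [hnorm] at h1
    simp only [Set.mem_ofPred_eq] at hn ⊢
    rw [le_div_iff₀ htpos] at hn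
    linarith
  have hfin : ∀ R, {n : ℤ | ‖k₀ + ((n * t : ℝ) : ℂ)‖ ≤ R}.Finite := by
    intro R
    -- The maximum with `0` covers radii for which the bound on `|n|` is negative.
    refine Set.Finite.subset (ncard_abs_le (le_max_right ((R + ‖k₀‖) / t) 0)).2 ?_
    exact (hsub R).trans fun n (hn : |(n : ℝ)| ≤ _) => show |(n : ℝ)| ≤ _ from
      hn.trans (le_max_left _ _)
  refine ⟨fun R => hk₀ R ▸ (hfin R).image _, 2 * ‖k₀‖ / t + 1, ?_⟩
  filter_upwards [eventually_ge_atTop ‖k₀‖] with R hR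
  have hk : 0 ≤ ‖k₀‖ := norm_nonneg _
  have hx1 : 0 ≤ (R + ‖k₀‖) / t := div_nonneg (by linarith) htpos.le
  have hx2 : 0 ≤ (R - ‖k₀‖) / t := div_nonneg (by linarith) htpos.le
  obtain ⟨c1, f1⟩ := ncard_abs_le hx1
  obtain ⟨c2, -⟩ := ncard_abs_le hx2
  have u : ((expFiber ℓ a R).ncard : ℝ) ≤ 2 * ⌊(R + ‖k₀‖) / t⌋ + 1 := by
    rw [hk₀, Set.ncard_image_of_injective _ hinj, ← c1]
    exact_mod_cast Set.ncard_le_ncard (hsub R) f1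
  have l : (2 * ⌊(R - ‖k₀‖) / t⌋ + 1 : ℝ) ≤ (expFiber ℓ a R).ncard := by
    rw [hk₀, Set.ncard_image_of_injective _ hinj, ← c2]
    exact_mod_cast Set.ncard_le_ncard (hsup R) (hfin R)
  have e1 := Int.floor_le ((R + ‖k₀‖) / t)
  have e2 := Int.lt_floor_add_one ((R - ‖k₀‖) / t)
  have e3 : ℓ / Real.pi * R = 2 * (R / t) := by
    rw [ht]; field_simp
  rw [add_div] at e1 u
  rw [sub_div] at e2 l
  rw [e3, mul_div_assoc, abs_le]
  constructor <;> linarith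

/-! ### The counting function -/

namespace MetricGraph

open Matrix Polynomial

variable {V E L : Type*} [Fintype E] [Fintype L] [DecidableEq V] [DecidableEq E] [DecidableEq L]
  {Γ : MetricGraph V E L} {ℓ : ℝ}

theorem charpolyRev_ne_zero {n : Type*} [Fintype n] [DecidableEq n] (M : Matrix n n ℂ) :
    M.charpolyRev ≠ 0 := by
  intro h
  have : eval 0 M.charpolyRev = 1 := eval_charpolyRev
  rw [h, eval_zero] at this
  exact zero_ne_one this

/-- The inner function has nowhere vanishing derivative, so composing with it preserves orders of
zeros. -/
theorem analyticOrderAt_eval_exp (hℓ : ℓ ≠ 0) {p : ℂ[X]} (hp : p ≠ 0) (k : ℂ) :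
    analyticOrderAt (fun z => p.eval (Complex.exp (Complex.I * z * ℓ))) k =
      p.roots.count (Complex.exp (Complex.I * k * ℓ)) := by
  have hℓ' : (ℓ : ℂ) ≠ 0 := by exact_mod_cast hℓ
  have h0 : HasDerivAt (fun z : ℂ => Complex.I * z * ℓ) (Complex.I * ℓ) k := by
    simpa using ((hasDerivAt_id k).const_mul Complex.I).mul_const (ℓ : ℂ)
  have han : AnalyticAt ℂ (fun z : ℂ => Complex.exp (Complex.I * z * ℓ)) k := by fun_prop
  have hd : deriv (fun z : ℂ => Complex.exp (Complex.I * z * ℓ)) k ≠ 0 := by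
    rw [h0.cexp.deriv]
    simp [hℓ']
  have := analyticOrderAt_comp_of_deriv_ne_zero (f := fun w => p.eval w) han hd
  rw [count_roots, ← Polynomial.analyticOrderAt_eval hp, ← this]
  rfl

theorem analyticAt_secularFactor {k : ℂ} (hk : k ≠ 0) : AnalyticAt ℂ (Γ.secularFactor ℓ) k := by
  refine AnalyticAt.div ?_ (by fun_prop) (by simp [hk])
  simp only [det_apply]
  refine Finset.analyticAt_fun_sum _ fun σ _ => ?_
  simp only [Units.smul_def, zsmul_eq_mul]
  refine analyticAt_const.mul ?_
  refine Finset.analyticAt_fun_prod _ fun i _ => ?_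
  simp only [Matrix.sub_apply, Matrix.smul_apply, smul_eq_mul]
  fun_prop

theorem multiplicity_eq (hΓ : Γ.IsEquilateral ℓ) (hℓ : ℓ ≠ 0) {k : ℂ} (hk : k ≠ 0) :
    Γ.multiplicity k =
      Γ.internalScattering.charpolyRev.roots.count (Complex.exp (Complex.I * k * ℓ)) := by
  have hp := charpolyRev_ne_zero Γ.internalScattering
  have hev : (fun z => (Γ.secularMatrix z).det) =ᶠ[nhds k] Γ.secularFactor ℓ *
      fun z => Γ.internalScattering.charpolyRev.eval (Complex.exp (Complex.I * z * ℓ)) := by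
    filter_upwards [isOpen_ne.mem_nhds hk] with z hz
    exact det_secularMatrix hΓ hz
  have hF := analyticAt_secularFactor (Γ := Γ) (ℓ := ℓ) hk
  have hE : AnalyticAt ℂ (fun z : ℂ => Complex.exp (Complex.I * z * ℓ)) k := by fun_prop
  have hG : AnalyticAt ℂ (fun z : ℂ =>
      Γ.internalScattering.charpolyRev.eval (Complex.exp (Complex.I * z * ℓ))) k := by
    simpa using AnalyticAt.aeval_polynomial hE Γ.internalScattering.charpolyRev
  rw [multiplicity, analyticOrderAt_congr hev, analyticOrderAt_mul hF hG,
    hF.analyticOrderAt_eq_zero.2 (secularFactor_ne_zero hk), zero_add,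
    analyticOrderAt_eval_exp hℓ hp]

/-- The factorization fails at `k = 0`, but it holds on a punctured neighbourhood. Infinite order
would make `p (exp (i z ℓ))`, with `p` the reversed characteristic polynomial, vanish identically
near `0`, although its order there is a finite root count. -/
theorem multiplicity_zero_ne_top (hΓ : Γ.IsEquilateral ℓ) (hℓ : ℓ ≠ 0) :
    Γ.multiplicity 0 ≠ ⊤ := by
  intro h
  rw [multiplicity, analyticOrderAt_eq_top] at h
  have h1 : ∀ᶠ z : ℂ in nhdsWithin 0 {0}ᶜ,
      Γ.internalScattering.charpolyRev.eval (Complex.exp (Complex.I * z * ℓ)) = 0 := by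
    filter_upwards [h.filter_mono nhdsWithin_le_nhds, self_mem_nhdsWithin] with z hz hz0
    rw [det_secularMatrix hΓ hz0] at hz
    exact (mul_eq_zero.1 hz).resolve_left (secularFactor_ne_zero hz0)
  have h2 := analyticOrderAt_eval_exp hℓ (charpolyRev_ne_zero Γ.internalScattering) 0
  have hE : AnalyticAt ℂ (fun z : ℂ => Complex.exp (Complex.I * z * ℓ)) 0 := by fun_prop
  have hG : AnalyticAt ℂ (fun z : ℂ =>
      Γ.internalScattering.charpolyRev.eval (Complex.exp (Complex.I * z * ℓ))) 0 := by
    simpa using AnalyticAt.aeval_polynomial hE Γ.internalScattering.charpolyRev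
  have h3 := hG.frequently_zero_iff_eventually_zero.1 h1.frequently
  rw [analyticOrderAt_eq_top.2 h3] at h2
  exact ENat.natCast_ne_top _ h2.symm

variable (Γ) in
/-- The number of zeros of `det (1 - exp (i k ℓ) S)` in the disc of radius `R`, with
multiplicities, where `S` is the internal scattering matrix. -/
noncomputable def scatteringCount (ℓ R : ℝ) : ℝ :=
  ∑ a ∈ Γ.internalScattering.charpolyRev.roots.toFinset,
    Γ.internalScattering.charpolyRev.roots.count a * ((expFiber ℓ a R).ncard : ℝ)

theorem ne_zero_of_mem_roots {n : Type*} [Fintype n] [DecidableEq n] {M : Matrix n n ℂ} {a : ℂ}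
    (ha : a ∈ M.charpolyRev.roots.toFinset) : a ≠ 0 := by
  rintro rfl
  have := (mem_roots'.1 (Multiset.mem_toFinset.1 ha)).2
  rw [IsRoot, eval_charpolyRev] at this
  exact one_ne_zero this

/-- Group the points of the disc by the value of `exp (i k ℓ)`. -/
theorem tsum_count_eq (hℓ : 0 < ℓ) (R : ℝ) :
    ∑' k : ℂ, Set.indicator {k : ℂ | ‖k‖ ≤ R} (fun k : ℂ =>
      (Γ.internalScattering.charpolyRev.roots.count (Complex.exp (Complex.I * k * ℓ)) : ℝ≥0∞)) k =
      ENNReal.ofReal (Γ.scatteringCount ℓ R) := by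
  set r := Γ.internalScattering.charpolyRev.roots with hr
  have h1 : ∀ k : ℂ, Set.indicator {k : ℂ | ‖k‖ ≤ R} (fun k : ℂ =>
      (r.count (Complex.exp (Complex.I * k * ℓ)) : ℝ≥0∞)) k =
      ∑ a ∈ r.toFinset, (r.count a : ℝ≥0∞) * (expFiber ℓ a R).indicator 1 k := by
    intro k
    by_cases hk : ‖k‖ ≤ R
    · rw [Set.indicator_of_mem (by exact hk)]
      by_cases hm : Complex.exp (Complex.I * k * ℓ) ∈ r.toFinset
      · rw [Finset.sum_eq_single_of_mem _ hm]
        · rw [Set.indicator_of_mem (show k ∈ expFiber ℓ _ R from ⟨hk, rfl⟩)]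
          simp
        · intro b _ hb
          rw [Set.indicator_of_notMem (fun h => hb h.2.symm), mul_zero]
      · rw [Multiset.count_eq_zero.2 fun h => hm (Multiset.mem_toFinset.2 h), Nat.cast_zero]
        refine (Finset.sum_eq_zero fun b hb => ?_).symm
        rw [Set.indicator_of_notMem (fun h : k ∈ expFiber ℓ b R => hm (h.2.symm ▸ hb)), mul_zero]
    · rw [Set.indicator_of_notMem (by exact hk)]
      refine (Finset.sum_eq_zero fun b hb => ?_).symm
      rw [Set.indicator_of_notMem (fun h => hk h.1), mul_zero]
  rw [tsum_congr h1, Summable.tsum_finsetSum fun _ _ => ENNReal.summable, scatteringCount,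
    ENNReal.ofReal_sum_of_nonneg fun _ _ => by positivity]
  refine Finset.sum_congr rfl fun a ha => ?_
  have hfin := (expFiber_count hℓ (ne_zero_of_mem_roots ha)).1 R
  rw [ENNReal.tsum_mul_left, ← tsum_subtype, ENNReal.ofReal_mul (by positivity),
    ENNReal.ofReal_natCast, ENNReal.ofReal_natCast]
  congr 1
  simp only [Pi.one_apply]
  rw [ENNReal.tsum_set_one, ← hfin.cast_ncard_eq]
  simp

/-- Over `ℂ` the root multiplicities add up to the degree, and the bounded errors of finitely many
roots add up to a bounded error. -/
theorem scatteringCount_asymptotics (hℓ : 0 < ℓ) :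
    ∃ C : ℝ, ∀ᶠ R : ℝ in atTop, |Γ.scatteringCount ℓ R -
      Γ.internalScattering.charpolyRev.natDegree * (ℓ / Real.pi) * R| ≤ C := by
  set p := Γ.internalScattering.charpolyRev with hp
  have h : ∀ a ∈ p.roots.toFinset, ∃ C : ℝ, ∀ᶠ R : ℝ in atTop,
      |((expFiber ℓ a R).ncard : ℝ) - ℓ / Real.pi * R| ≤ C := fun a ha =>
    (expFiber_count hℓ (ne_zero_of_mem_roots ha)).2
  choose! C hC using h
  refine ⟨∑ a ∈ p.roots.toFinset, p.roots.count a * C a, ?_⟩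
  filter_upwards [(Filter.eventually_all_finset _).2 hC] with R hR
  have hdeg : (p.natDegree : ℝ) = ∑ a ∈ p.roots.toFinset, (p.roots.count a : ℝ) := by
    rw [← Nat.cast_sum, Multiset.toFinset_sum_count_eq, IsAlgClosed.card_roots_eq_natDegree]
  rw [scatteringCount, ← hp, hdeg, Finset.sum_mul, Finset.sum_mul, ← Finset.sum_sub_distrib]
  refine (Finset.abs_sum_le_sum_abs _ _).trans (Finset.sum_le_sum fun a ha => ?_)
  rw [mul_assoc, ← mul_sub, abs_mul, Nat.abs_cast]
  exact mul_le_mul_of_nonneg_left (hR a ha) (Nat.cast_nonneg _)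

theorem scatteringCount_nonneg (ℓ R : ℝ) : 0 ≤ Γ.scatteringCount ℓ R := by
  unfold scatteringCount; positivity

theorem resonanceCount_bounds (hΓ : Γ.IsEquilateral ℓ) (hℓ : 0 < ℓ) :
    ∃ C : ℝ, ∀ R, Γ.resonanceCount R ≠ ∞ ∧
      |(Γ.resonanceCount R).toReal - Γ.scatteringCount ℓ R| ≤ C := by
  set m : ℂ → ℝ≥0∞ := fun k =>
    (Γ.internalScattering.charpolyRev.roots.count (Complex.exp (Complex.I * k * ℓ)) : ℝ≥0∞)
    with hm
  -- The two counts can differ only at `k = 0`. The sum of both contributions there bounds the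
  -- difference in either direction, uniformly in `R`.
  set c : ℝ≥0∞ := (Γ.multiplicity 0 : ℝ≥0∞) + m 0 with hc
  have hctop : c ≠ ∞ := by
    refine ENNReal.add_ne_top.2 ⟨?_, ENNReal.natCast_ne_top _⟩
    simpa using multiplicity_zero_ne_top hΓ hℓ.ne'
  have hmult : ∀ k : ℂ, k ≠ 0 → (Γ.multiplicity k : ℝ≥0∞) = m k := by
    intro k hk
    rw [multiplicity_eq hΓ hℓ.ne' hk]
    simp [hm]
  have hres : ∀ k : ℂ, k ≠ 0 → m k ≠ 0 → Γ.IsResonance k := by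
    intro k hk hmk
    refine isResonance_of_det_eq_zero hΓ hk ?_
    refine apply_eq_zero_of_analyticOrderAt_ne_zero (f := fun z => (Γ.secularMatrix z).det) ?_
    intro h0
    refine hmk ?_
    rw [← hmult k hk, multiplicity, h0]
    simp
  refine ⟨c.toReal, fun R => ?_⟩
  have hcount : Γ.resonanceCount R = ∑' k : ℂ, Set.indicator {k | Γ.IsResonance k ∧ ‖k‖ ≤ R}
      (fun k => (Γ.multiplicity k : ℝ≥0∞)) k :=
    tsum_subtype {k | Γ.IsResonance k ∧ ‖k‖ ≤ R} fun k => (Γ.multiplicity k : ℝ≥0∞)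
  have hT := tsum_count_eq (Γ := Γ) hℓ R
  have hsingle : ∑' k : ℂ, (Pi.single 0 c : ℂ → ℝ≥0∞) k = c := tsum_pi_single 0 c
  have hle1 : Γ.resonanceCount R ≤ ENNReal.ofReal (Γ.scatteringCount ℓ R) + c := by
    rw [hcount, ← hT, ← hsingle, ← ENNReal.tsum_add]
    refine ENNReal.tsum_le_tsum fun k => ?_
    by_cases hk : k ∈ {k | Γ.IsResonance k ∧ ‖k‖ ≤ R}
    swap
    · rw [Set.indicator_of_notMem hk]
      exact zero_le
    rw [Set.indicator_of_mem hk]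
    rcases eq_or_ne k 0 with rfl | hk0
    · rw [Pi.single_eq_same, hc]
      exact le_add_left (le_add_right le_rfl)
    · rw [Set.indicator_of_mem (by exact hk.2), hmult k hk0]
      exact le_add_right le_rfl
  have hle2 : ENNReal.ofReal (Γ.scatteringCount ℓ R) ≤ Γ.resonanceCount R + c := by
    rw [hcount, ← hT, ← hsingle, ← ENNReal.tsum_add]
    refine ENNReal.tsum_le_tsum fun k => ?_
    by_cases hk : k ∈ {k : ℂ | ‖k‖ ≤ R}
    swap
    · rw [Set.indicator_of_notMem hk]
      exact zero_le
    rw [Set.indicator_of_mem hk]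
    change m k ≤ _
    rcases eq_or_ne k 0 with rfl | hk0
    · rw [Pi.single_eq_same, hc]
      exact le_add_left (le_add_left le_rfl)
    · rcases eq_or_ne (m k) 0 with h0 | h0
      · exact h0.le.trans zero_le
      · rw [Set.indicator_of_mem (show k ∈ {k | Γ.IsResonance k ∧ ‖k‖ ≤ R} from
          ⟨hres k hk0 h0, hk⟩), hmult k hk0]
        exact le_add_right le_rfl
  have htop : Γ.resonanceCount R ≠ ∞ :=
    ne_top_of_le_ne_top (ENNReal.add_ne_top.2 ⟨ENNReal.ofReal_ne_top, hctop⟩) hle1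
  refine ⟨htop, ?_⟩
  have r1 := ENNReal.toReal_mono (ENNReal.add_ne_top.2 ⟨ENNReal.ofReal_ne_top, hctop⟩) hle1
  have r2 := ENNReal.toReal_mono (ENNReal.add_ne_top.2 ⟨htop, hctop⟩) hle2
  rw [ENNReal.toReal_add ENNReal.ofReal_ne_top hctop,
    ENNReal.toReal_ofReal (scatteringCount_nonneg ℓ R)] at r1
  rw [ENNReal.toReal_add htop hctop, ENNReal.toReal_ofReal (scatteringCount_nonneg ℓ R)] at r2
  rw [abs_le]
  constructor <;> linarith

/-! ### Value and uniqueness of the effective size -/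

theorem isEffectiveSize (hΓ : Γ.IsEquilateral ℓ) (hℓ : 0 < ℓ) :
    Γ.IsEffectiveSize (Γ.internalScattering.charpolyRev.natDegree * ℓ / 2) := by
  obtain ⟨C₁, h₁⟩ := resonanceCount_bounds hΓ hℓ
  obtain ⟨C₂, h₂⟩ := scatteringCount_asymptotics (Γ := Γ) hℓ
  refine ⟨fun R => (h₁ R).1, IsBigO.of_bound (C₁ + C₂) ?_⟩
  filter_upwards [h₂] with R hR
  have e : 2 / Real.pi * (Γ.internalScattering.charpolyRev.natDegree * ℓ / 2) * R =
      Γ.internalScattering.charpolyRev.natDegree * (ℓ / Real.pi) * R := by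
    field_simp
  rw [e, norm_one, mul_one, Real.norm_eq_abs]
  exact (abs_sub_le _ _ _).trans (add_le_add (h₁ R).2 hR)

/-- Two different sizes would make a nonzero multiple of `R` bounded. -/
theorem IsEffectiveSize.unique {W W' : ℝ} (h : Γ.IsEffectiveSize W) (h' : Γ.IsEffectiveSize W') :
    W = W' := by
  by_contra hne
  have h1 : (fun R : ℝ => (2 / Real.pi * (W - W')) * R) =O[atTop] fun _ => (1 : ℝ) := by
    refine (h'.2.sub h.2).congr_left fun R => ?_
    ring
  have hc : 2 / Real.pi * (W - W') ≠ 0 :=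
    mul_ne_zero (div_ne_zero two_ne_zero Real.pi_ne_zero) (sub_ne_zero.2 hne)
  have h2 : (fun R : ℝ => R) =O[atTop] fun _ => (1 : ℝ) :=
    (isBigO_const_mul_self (2 / Real.pi * (W - W'))⁻¹ _ atTop |>.trans h1).congr_left fun R => by
      rw [inv_mul_cancel_left₀ hc]
  exact not_isBoundedUnder_of_tendsto_atTop tendsto_norm_atTop_atTop ((isBigO_one_iff ℝ).1 h2)

end MetricGraph

theorem mainTheorem1 {V E L : Type*} [Fintype V] [Fintype E] [Fintype L]
    [DecidableEq V] [DecidableEq E] [DecidableEq L]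
    (Γ : MetricGraph V E L) (ℓ : ℝ) (hℓ : Γ.IsEquilateral ℓ)
    (hdeg : ∀ v, 0 < Γ.degree v) :
    (∃ W : ℝ, Γ.IsEffectiveSize W) ∧
      ∀ W : ℝ, Γ.IsEffectiveSize W →
        W ≤ (Fintype.card E : ℝ) * ℓ - ℓ / 2 * (Γ.numBalanced : ℝ)
          - ℓ / 2 * (Γ.numBalancedNonneighbouring : ℝ) := by
  have hd := Γ.natDegree_charpolyRev_add_le hdeg
  rcases isEmpty_or_nonempty E with hE | ⟨⟨e⟩⟩
  -- Without internal edges the sign of `ℓ` is not determined and every length is vacuously the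
  -- common one, so `1` serves. The degree bound then forces all counts to be `0`.
  · have hW := MetricGraph.isEffectiveSize (Γ := Γ) (ℓ := 1) (fun e => isEmptyElim e) one_pos
    refine ⟨⟨_, hW⟩, fun W hW' => ?_⟩
    rw [Fintype.card_eq_zero] at hd ⊢
    rw [hW'.unique hW, show Γ.internalScattering.charpolyRev.natDegree = 0 by omega,
      show Γ.numBalanced = 0 by omega, show Γ.numBalancedNonneighbouring = 0 by omega]
    simp
  · have hpos : 0 < ℓ := hℓ e ▸ Γ.length_pos e
    have hW := MetricGraph.isEffectiveSize hℓ hpos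
    refine ⟨⟨_, hW⟩, fun W hW' => ?_⟩
    rw [hW'.unique hW]
    have hd' : (Γ.internalScattering.charpolyRev.natDegree + Γ.numBalanced +
        Γ.numBalancedNonneighbouring : ℝ) ≤ 2 * Fintype.card E := by exact_mod_cast hd
    nlinarith
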